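/- Let $\mathbb{S}^1=\mathbb{R}/\mathbb{Z}$, let $\tau\in[0,1)$ and let $l_1,l_2,l_3>0$ be real numbers with $l_1+l_2+l_3=1$. Put $a_0=0$, $a_1=l_1$, $a_2=l_1+l_2$, $a_3=1$. The fully flipped $3$-interval exchange transformation on the circle $F=F_{\tau,l_1,l_2,l_3}:\mathbb{S}^1\to\mathbb{S}^1$ flips each of the three intervals $[a_{i-1},a_i)$ and then rotates the circle by $\tau$: $$F(x)=a_{i-1}+a_i-x+\tau \pmod 1\qquad\text{for } x\in[a_{i-1},a_i),\quad i=1,2,3.$$ This map is a bijection of $\mathbb{S}^1$, and it is called minimal if for every $x\in\mathbb{S}^1$ the orbit $\{F^n(x): n\in\mathbb{Z}\}$ is dense in $\mathbb{S}^1$. Theorem. If $F_{\tau,l_1,l_2,l_3}$ is minimal, then $\tau=\frac12$. -/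

import Mathlib

/-- The two-sided orbit of `x` under a self-map `f`: all points `y` reached from `x`, or reaching
`x`, by iterating `f`. For a bijection `f` this is `{f ^ n x | n : ℤ}`. -/
def fullOrbit {X : Type*} (f : X → X) (x : X) : Set X :=
  {y | ∃ n : ℕ, f^[n] x = y ∨ f^[n] y = x}

/-- A (bijective) self-map of a topological space is minimal if all its orbits are dense. -/
def IsMinimalMap {X : Type*} [TopologicalSpace X] (f : X → X) : Prop :=
  ∀ x : X, Dense (fullOrbit f x)

/-- The fully flipped 3-interval exchange transformation `F_{τ, l₁, l₂, l₃}` of the circle `ℝ / ℤ`,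
with the trivial permutation of the intervals. A point of the circle is represented by
`t ∈ [0, 1)`; on each of the intervals `[u, v)` equal to `[0, l₁)`, `[l₁, l₁ + l₂)`,
`[l₁ + l₂, l₁ + l₂ + l₃)`, the map is the flip `t ↦ u + v - t` followed by the rotation by `τ`. -/
noncomputable def flippedCET3 (τ l₁ l₂ l₃ : ℝ) (x : UnitAddCircle) : UnitAddCircle :=
  let t : ℝ := (AddCircle.equivIco (1 : ℝ) 0 x : ℝ)
  if t < l₁ then
    ((0 + l₁ - t + τ : ℝ) : UnitAddCircle)
  else if t < l₁ + l₂ then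
    ((l₁ + (l₁ + l₂) - t + τ : ℝ) : UnitAddCircle)
  else
    (((l₁ + l₂) + (l₁ + l₂ + l₃) - t + τ : ℝ) : UnitAddCircle)

/-!
The proof compares densities of vertices and edges in a graph. If some interval is longer than `τ`
or `1 - τ`, the map has a fixed point (`exists_fixed`) and is not minimal, being injective. Otherwise
let `u` be the distance of a point from the left end of its interval (`leftDist`). In passing from
`x` to `F x`, the sum of the two values of `u` is `τ` or `τ - l k` (`leftDist_add_leftDist`). So `u`,
taken alternately as it is and reflected in `[0, τ]`, moves along orbits of the three partial
translations of `[0, τ]` by `l 0`, `l 1`, `l 2`. A finite orbit of these would give a finite subset of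
the circle invariant under `F` in both directions, against minimality (`not_isMinimalMap_of_dist`).

The orbits of the partial translations are the clusters of the triangular lattice `ℤ × ℤ` formed by
the points whose phase `θ + m * l 0 + n * l 1` modulo `1` lies in an interval of length `b = τ`. If all
clusters are infinite, a large box contains, up to boundary terms, at least as many edges of clusters
as vertices. Averaged over `θ`, the density of vertices is `b` and that of edges is
`∑ k, (b - l k) = 3 * b - 1`, whence `b ≥ 1 / 2` (`exists_finite_stable`). Distances from the right end
(`rightDist`) give the same with `b = 1 - τ`, so `τ = 1 / 2`.
-/

/-! ### Counting edges of a finite graph -/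

/-- If every nonempty subset of `K` is joined by an edge to its complement, then `K` meets at least
`K.card` edges: an edge leaving `K` through `v` no longer meets `K \ {v}`. -/
lemma card_le_card_edges {V ι : Type*} [DecidableEq V] (E : Finset ι) (s t : ι → V)
    (K : Finset V)
    (h : ∀ K' ⊆ K, K'.Nonempty →
      ∃ e ∈ E, (s e ∈ K' ∧ t e ∉ K') ∨ (t e ∈ K' ∧ s e ∉ K')) :
    K.card ≤ (E.filter fun e => s e ∈ K ∨ t e ∈ K).card := by
  classical
  induction K using Finset.strongInduction with
  | H K ih =>
    rcases K.eq_empty_or_nonempty with rfl | hK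
    · simp
    have key : ∀ v ∈ K, ∀ e ∈ E, ((s e = v ∧ t e ∉ K) ∨ (t e = v ∧ s e ∉ K)) →
        K.card ≤ (E.filter fun e => s e ∈ K ∨ t e ∈ K).card := by
      intro v hv e he hev
      have h1 := ih (K.erase v) (Finset.erase_ssubset hv)
        fun K' hK' => h K' (hK'.trans (Finset.erase_subset _ _))
      have h2 : (E.filter fun e => s e ∈ K.erase v ∨ t e ∈ K.erase v) ⊂
          E.filter fun e => s e ∈ K ∨ t e ∈ K := by
        rw [Finset.ssubset_iff_of_subset]
        · refine ⟨e, ?_, ?_⟩ <;> simp only [Finset.mem_filter, Finset.mem_erase] <;> grind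
        · intro e'
          simp only [Finset.mem_filter, Finset.mem_erase]
          tauto
      have h3 := Finset.card_lt_card h2
      rw [Finset.card_erase_of_mem hv] at h1
      omega
    obtain ⟨e, he, ⟨h1, h2⟩ | ⟨h1, h2⟩⟩ := h K subset_rfl hK
    · exact key _ h1 e he (Or.inl ⟨rfl, h2⟩)
    · exact key _ h1 e he (Or.inr ⟨rfl, h2⟩)

/-! ### Finite stable sets of a system of partial translations -/

/-- The step of the triangular lattice `ℤ × ℤ` along which the phase `θ + m * l 0 + n * l 1`
increases by `l k` modulo `1`, when `l 0 + l 1 + l 2 = 1`. -/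
def latticeStep : Fin 3 → ℤ × ℤ := ![(1, 0), (0, 1), (-1, -1)]

/-- The phase in `[0, 1)` of a lattice point. -/
noncomputable def latticePhase (l : Fin 3 → ℝ) (θ : ℝ) (v : ℤ × ℤ) : ℝ :=
  Int.fract (θ + (v.1 * l 0 + v.2 * l 1))

lemma latticePhase_add_step {l : Fin 3 → ℝ} (hl : l 0 + l 1 + l 2 = 1) (θ : ℝ) (v : ℤ × ℤ)
    (k : Fin 3) :
    latticePhase l θ (v + latticeStep k) = Int.fract (latticePhase l θ v + l k) := by
  have hfl := Int.floor_add_fract (θ + (v.1 * l 0 + v.2 * l 1))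
  unfold latticePhase
  rw [Int.fract_eq_fract]
  fin_cases k
  · refine ⟨⌊θ + (v.1 * l 0 + v.2 * l 1)⌋, ?_⟩
    simp [latticeStep]
    linarith
  · refine ⟨⌊θ + (v.1 * l 0 + v.2 * l 1)⌋, ?_⟩
    simp [latticeStep]
    linarith
  · refine ⟨⌊θ + (v.1 * l 0 + v.2 * l 1)⌋ - 1, ?_⟩
    simp [latticeStep]
    linarith

lemma latticePhase_mem_Ico (l : Fin 3 → ℝ) (θ : ℝ) (v : ℤ × ℤ) :
    latticePhase l θ v ∈ Set.Ico (0 : ℝ) 1 :=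
  ⟨Int.fract_nonneg _, Int.fract_lt_one _⟩

open MeasureTheory in
lemma intervalIntegrable_fract_lt (c d a b : ℝ) :
    IntervalIntegrable (fun θ => if Int.fract (θ + c) < d then (1 : ℝ) else 0) volume a b := by
  have hm : Measurable fun θ : ℝ => if Int.fract (θ + c) < d then (1 : ℝ) else 0 :=
    Measurable.ite (measurableSet_lt (by fun_prop) measurable_const) measurable_const
      measurable_const
  refine (intervalIntegrable_const (c := (1 : ℝ))).mono_fun hm.aestronglyMeasurable
    (Filter.Eventually.of_forall fun θ => ?_)
  dsimp only
  split_ifs <;> simp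

open MeasureTheory in
lemma integral_fract_lt (c : ℝ) {d : ℝ} (hd₀ : 0 ≤ d) (hd₁ : d ≤ 1) :
    ∫ θ in (0 : ℝ)..1, (if Int.fract (θ + c) < d then (1 : ℝ) else 0) = d := by
  have hper : Function.Periodic (fun x : ℝ => if Int.fract x < d then (1 : ℝ) else 0) 1 := by
    intro x
    simp
  have h1 := hper.intervalIntegral_add_eq c 0
  rw [intervalIntegral.integral_comp_add_right
    (fun x : ℝ => if Int.fract x < d then (1 : ℝ) else 0), zero_add, add_comm 1 c, h1, zero_add]
  have hint := fun a b => by simpa using intervalIntegrable_fract_lt 0 d a b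
  rw [← intervalIntegral.integral_add_adjacent_intervals (hint 0 d) (hint d 1)]
  have h2 : ∫ x in (0 : ℝ)..d, (if Int.fract x < d then (1 : ℝ) else 0)
      = ∫ x in (0 : ℝ)..d, (1 : ℝ) := by
    refine intervalIntegral.integral_congr_Ioo_of_le hd₀ fun x hx => ?_
    have : Int.fract x = x := Int.fract_eq_self.2 ⟨hx.1.le, hx.2.trans_le hd₁⟩
    simp [this, hx.2]
  have h3 : ∫ x in d..(1 : ℝ), (if Int.fract x < d then (1 : ℝ) else 0)
      = ∫ x in d..(1 : ℝ), (0 : ℝ) := by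
    refine intervalIntegral.integral_congr_Ioo_of_le hd₁ fun x hx => ?_
    have : Int.fract x = x := Int.fract_eq_self.2 ⟨hd₀.trans hx.1.le, hx.2⟩
    simp [this, hx.1.le]
  rw [h2, h3]
  simp

/-- If the partial translations `t ↦ t + l k` of `[0, b)` have no finite stable set, then, for
every phase `θ`, the lattice points of a box with phase below `b` are at most as many as the edges
of the lattice, based in the slightly larger box, that join two points with phase below `b`. -/
lemma sum_vertices_le_sum_edges {l : Fin 3 → ℝ} {b : ℝ} (hl₀ : ∀ k, 0 < l k)
    (hl : l 0 + l 1 + l 2 = 1) (hb : b ≤ 1)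
    (hC : ∀ C : Finset ℝ, C.Nonempty → (∀ t ∈ C, 0 ≤ t ∧ t < b) →
      ∃ t ∈ C, ∃ k, (t + l k < b ∧ t + l k ∉ C) ∨ (0 ≤ t - l k ∧ t - l k ∉ C))
    (N : ℕ) (θ : ℝ) :
    ∑ v ∈ Finset.Ico (0 : ℤ) N ×ˢ Finset.Ico (0 : ℤ) N,
      (if latticePhase l θ v < b then (1 : ℝ) else 0) ≤
    ∑ v ∈ Finset.Ico (-1 : ℤ) (N + 1) ×ˢ Finset.Ico (-1 : ℤ) (N + 1), ∑ k,
      (if latticePhase l θ v < b - l k then (1 : ℝ) else 0) := by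
  classical
  rw [← Finset.sum_product', ← Finset.sum_filter, ← Finset.sum_filter]
  simp only [Finset.sum_const, nsmul_eq_mul, mul_one, Nat.cast_le]
  refine (card_le_card_edges _ (fun e : (ℤ × ℤ) × Fin 3 => e.1) (fun e => e.1 + latticeStep e.2) _
    fun K hK hne => ?_).trans (Finset.card_filter_le _ _)
  have hKv : ∀ v ∈ K, (0 ≤ v.1 ∧ v.1 < N) ∧ (0 ≤ v.2 ∧ v.2 < N) ∧ latticePhase l θ v < b := by
    intro v hv
    have := hK hv
    simp only [Finset.mem_filter, Finset.mem_product, Finset.mem_Ico] at this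
    tauto
  obtain ⟨t, ht, k, hk⟩ := hC (K.image (latticePhase l θ)) (hne.image _) (by
    intro t ht
    obtain ⟨v, hv, rfl⟩ := Finset.mem_image.1 ht
    exact ⟨(latticePhase_mem_Ico l θ v).1, (hKv v hv).2.2⟩)
  obtain ⟨v, hv, rfl⟩ := Finset.mem_image.1 ht
  obtain ⟨⟨hv1, hv2⟩, ⟨hv3, hv4⟩, hv5⟩ := hKv v hv
  have hph := latticePhase_mem_Ico l θ v
  rcases hk with ⟨hk1, hk2⟩ | ⟨hk1, hk2⟩
  · refine ⟨(v, k), ?_, Or.inl ⟨hv, fun h => hk2 ?_⟩⟩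
    · simp only [Finset.mem_filter, Finset.mem_product, Finset.mem_Ico, Finset.mem_univ, and_true]
      exact ⟨⟨⟨by omega, by omega⟩, by omega, by omega⟩, by linarith⟩
    · refine Finset.mem_image.2 ⟨_, h, ?_⟩
      rw [latticePhase_add_step hl]
      exact Int.fract_eq_self.2 ⟨by linarith [hl₀ k, hph.1], by linarith⟩
  · have hphase : latticePhase l θ (v - latticeStep k) = latticePhase l θ v - l k := by
      have h1 := latticePhase_add_step hl θ (v - latticeStep k) k
      rw [sub_add_cancel] at h1
      have h2 : latticePhase l θ (v - latticeStep k) =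
          Int.fract (latticePhase l θ v - l k) := by
        rw [← Int.fract_eq_self.2 (latticePhase_mem_Ico l θ (v - latticeStep k)),
          Int.fract_eq_fract, h1, Int.fract]
        exact ⟨⌊latticePhase l θ (v - latticeStep k) + l k⌋, by ring⟩
      rw [h2]
      exact Int.fract_eq_self.2 ⟨hk1, by linarith [hl₀ k, hph.2]⟩
    refine ⟨(v - latticeStep k, k), ?_, Or.inr ⟨by simpa using hv, fun h => hk2 ?_⟩⟩
    · simp only [Finset.mem_filter, Finset.mem_product, Finset.mem_Ico, Finset.mem_univ, and_true,
        hphase]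
      refine ⟨?_, by linarith⟩
      fin_cases k <;> simp [latticeStep] <;> omega
    · exact Finset.mem_image.2 ⟨_, h, hphase⟩

/-- If `b < 1 / 2`, the partial translations by `l 0`, `l 1`, `l 2` of an interval of length `b`
have a finite stable set. The phases of a lattice point and of an edge are uniformly distributed,
so lattice points of a large box have phase below `b` with frequency `b`, edges have both ends
below `b` with frequency `3 * b - 1 < b`. -/
lemma exists_finite_stable {l : Fin 3 → ℝ} {b : ℝ} (hl₀ : ∀ k, 0 < l k)
    (hl : l 0 + l 1 + l 2 = 1) (hlb : ∀ k, l k ≤ b) (hb : b < 1 / 2) :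
    ∃ C : Finset ℝ, C.Nonempty ∧ (∀ t ∈ C, 0 ≤ t ∧ t < b) ∧
      ∀ t ∈ C, ∀ k, (t + l k < b → t + l k ∈ C) ∧ (0 ≤ t - l k → t - l k ∈ C) := by
  by_contra hcon
  have hC : ∀ C : Finset ℝ, C.Nonempty → (∀ t ∈ C, 0 ≤ t ∧ t < b) →
      ∃ t ∈ C, ∃ k, (t + l k < b ∧ t + l k ∉ C) ∨ (0 ≤ t - l k ∧ t - l k ∉ C) := by
    intro C h1 h2
    by_contra h3
    refine hcon ⟨C, h1, h2, fun t ht k => ⟨fun h => ?_, fun h => ?_⟩⟩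
    · by_contra h4
      exact h3 ⟨t, ht, k, Or.inl ⟨h, h4⟩⟩
    · by_contra h4
      exact h3 ⟨t, ht, k, Or.inr ⟨h, h4⟩⟩
  have hb₀ : 0 < b := (hl₀ 0).trans_le (hlb 0)
  have hint : ∀ (v : ℤ × ℤ) (d : ℝ), IntervalIntegrable
      (fun θ => if latticePhase l θ v < d then (1 : ℝ) else 0) MeasureTheory.volume 0 1 :=
    fun v d => intervalIntegrable_fract_lt _ _ _ _
  have hval : ∀ (v : ℤ × ℤ) (d : ℝ), 0 ≤ d → d ≤ 1 →
      ∫ θ in (0 : ℝ)..1, (if latticePhase l θ v < d then (1 : ℝ) else 0) = d :=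
    fun v d => integral_fract_lt _
  have hsum : ∀ v : ℤ × ℤ, IntervalIntegrable
      (fun θ => ∑ k, if latticePhase l θ v < b - l k then (1 : ℝ) else 0)
      MeasureTheory.volume 0 1 := fun v => by
    simpa only [Finset.sum_fn] using IntervalIntegrable.sum Finset.univ fun k _ => hint v (b - l k)
  have main : ∀ N : ℕ, (N : ℝ) ^ 2 * b ≤ ((N : ℝ) + 2) ^ 2 * (3 * b - 1) := by
    intro N
    have h := intervalIntegral.integral_mono_on (μ := MeasureTheory.volume) zero_le_one
      (by simpa only [Finset.sum_fn] using IntervalIntegrable.sum _ fun v _ => hint v b)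
      (by simpa only [Finset.sum_fn] using IntervalIntegrable.sum _ fun v _ => hsum v)
      (fun θ _ => sum_vertices_le_sum_edges hl₀ hl (by linarith) hC N θ)
    rw [intervalIntegral.integral_finsetSum fun v _ => hint v b,
      intervalIntegral.integral_finsetSum fun v _ => hsum v] at h
    have h1 : ∀ v : ℤ × ℤ, (∫ θ in (0 : ℝ)..1, ∑ k,
        (if latticePhase l θ v < b - l k then (1 : ℝ) else 0)) = 3 * b - 1 := by
      intro v
      rw [intervalIntegral.integral_finsetSum fun k _ => hint v (b - l k)]
      rw [Finset.sum_congr rfl fun k _ => hval v (b - l k) (by linarith [hlb k])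
        (by linarith [hl₀ k])]
      rw [Fin.sum_univ_three]
      linarith
    rw [Finset.sum_congr rfl fun v _ => hval v b hb₀.le (by linarith),
      Finset.sum_congr rfl fun v _ => h1 v] at h
    simp only [Finset.sum_const, Finset.card_product, Int.card_Ico, nsmul_eq_mul] at h
    have h2 : ((N : ℤ) + 1 - -1).toNat = N + 2 := by omega
    rw [h2] at h
    push_cast at h
    simp only [sub_zero, Int.toNat_natCast] at h
    linarith
  obtain ⟨N, hN⟩ := exists_nat_gt (8 / (1 - 2 * b))
  have hδ : 0 < 1 - 2 * b := by linarith
  rw [div_lt_iff₀ hδ] at hN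
  have hN1 : (1 : ℝ) ≤ N := by
    rcases Nat.eq_zero_or_pos N with rfl | h
    · simp at hN
      linarith
    · exact_mod_cast h
  have h := main N
  nlinarith [mul_lt_mul_of_pos_left hN (by linarith : (0 : ℝ) < N)]

/-- A finite stable set of the half-open interval can be pushed to the right by a small amount, so
that it avoids the end points and is stable in the closed interval. -/
lemma exists_finite_stable_interior {l : Fin 3 → ℝ} {b : ℝ} (hl₀ : ∀ k, 0 < l k)
    (hl : l 0 + l 1 + l 2 = 1) (hlb : ∀ k, l k ≤ b) (hb : b < 1 / 2) :
    ∃ C : Finset ℝ, C.Nonempty ∧ (∀ t ∈ C, 0 < t ∧ t < b) ∧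
      ∀ t ∈ C, ∀ k, (t + l k ≤ b → t + l k ∈ C) ∧ (0 ≤ t - l k → t - l k ∈ C) := by
  obtain ⟨C, hne, hCb, hst⟩ := exists_finite_stable hl₀ hl hlb hb
  have hev : ∀ᶠ ε in nhdsWithin (0 : ℝ) (Set.Ioi 0), ∀ t ∈ C, t + ε < b ∧
      ∀ k, t - l k < 0 → t - l k + ε < 0 := by
    have hlt : ∀ t a : ℝ, t < a → ∀ᶠ ε in nhdsWithin (0 : ℝ) (Set.Ioi 0), t + ε < a := by
      intro t a h
      filter_upwards [Ioo_mem_nhdsGT (sub_pos.2 h)] with ε hε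
      linarith [hε.2]
    refine (Filter.eventually_all_finset C).2 fun t ht => (hlt t b (hCb t ht).2).and ?_
    refine Filter.eventually_all.2 fun k => ?_
    by_cases h : t - l k < 0
    · filter_upwards [hlt _ _ h] with ε hε _ using hε
    · exact Filter.Eventually.of_forall fun ε h' => absurd h' h
  obtain ⟨ε, hε, hε₀⟩ := (hev.and self_mem_nhdsWithin).exists
  replace hε₀ : 0 < ε := hε₀
  refine ⟨C.image (· + ε), hne.image _, ?_, ?_⟩
  · simp only [Finset.forall_mem_image]
    exact fun t ht => ⟨by linarith [(hCb t ht).1], (hε t ht).1⟩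
  · simp only [Finset.forall_mem_image]
    refine fun t ht k => ⟨fun h => ?_, fun h => ?_⟩
    · exact Finset.mem_image.2 ⟨t + l k, (hst t ht k).1 (by linarith), by ring⟩
    · refine Finset.mem_image.2 ⟨t - l k, (hst t ht k).2 ?_, by ring⟩
      by_contra h'
      linarith [(hε t ht).2 k (not_le.1 h')]

/-! ### Finite invariant sets -/

/-- Invariance in both directions confines the two-sided orbit of a point of `D` to `D`, a finite
closed set. -/
lemma not_isMinimalMap_of_finite {X : Type*} [TopologicalSpace X] [T1Space X] [Infinite X]
    {f : X → X} {D : Set X} (hfin : D.Finite) (hne : D.Nonempty) (hD : ∀ x, x ∈ D ↔ f x ∈ D) :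
    ¬ IsMinimalMap f := by
  intro hmin
  obtain ⟨x, hx⟩ := hne
  have hiter : ∀ (n : ℕ) (y : X), y ∈ D ↔ f^[n] y ∈ D := by
    intro n
    induction n with
    | zero => simp
    | succ n ih =>
      intro y
      rw [Function.iterate_succ_apply, ← ih, ← hD]
  have hsub : fullOrbit f x ⊆ D := by
    rintro y ⟨n, h | h⟩
    · rw [← h]
      exact (hiter n x).1 hx
    · exact (hiter n y).2 (h ▸ hx)
  have huniv := (hmin x).mono hsub
  rw [dense_iff_closure_eq, hfin.isClosed.closure_eq] at huniv
  exact Set.infinite_univ (huniv ▸ hfin)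

/-- If a function `w` changes under `f` by a reflection of `[0, b]` followed by at most one of the
translations `-l k` (up to an exceptional case at the end points), then a finite stable set of these
translations pulls back to a finite invariant set of `f`. -/
lemma not_isMinimalMap_of_dist {X : Type*} [TopologicalSpace X] [T1Space X] [Infinite X]
    {f : X → X} {l : Fin 3 → ℝ} {b : ℝ} (hl₀ : ∀ k, 0 < l k) (hl : l 0 + l 1 + l 2 = 1)
    (hlb : ∀ k, l k ≤ b) (hb : b < 1 / 2) (w : X → ℝ)
    (hw : ∀ x, w x + w (f x) = b ∨ (∃ k, w x + w (f x) = b - l k) ∨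
      ((w x = 0 ∨ w x = b) ∧ (w (f x) = 0 ∨ w (f x) = b)))
    (hw₀ : ∀ x, 0 ≤ w x) (hfib : ∀ c, {x | w x = c}.Finite)
    (hsurj : ∀ c, 0 < c → c < l 0 → ∃ x, w x = c) : ¬ IsMinimalMap f := by
  obtain ⟨C, hne, hCb, hC⟩ := exists_finite_stable_interior hl₀ hl hlb hb
  have hhalf : ∀ u u' : ℝ, 0 ≤ u → 0 ≤ u' → (u + u' = b ∨ (∃ k, u + u' = b - l k) ∨
      ((u = 0 ∨ u = b) ∧ (u' = 0 ∨ u' = b))) → (u ∈ C ∨ b - u ∈ C) → (u' ∈ C ∨ b - u' ∈ C) := by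
    rintro u u' hu hu' (h | ⟨k, h⟩ | ⟨h, -⟩) (h1 | h1)
    · exact Or.inr (by rwa [show b - u' = u by linarith])
    · exact Or.inl (by rwa [show u' = b - u by linarith])
    · refine Or.inr ?_
      rw [show b - u' = u + l k by linarith]
      exact (hC u h1 k).1 (by linarith)
    · refine Or.inl ?_
      rw [show u' = b - u - l k by linarith]
      exact (hC _ h1 k).2 (by linarith)
    · have := hCb _ h1
      rcases h with h | h <;> linarith
    · have := hCb _ h1
      rcases h with h | h <;> linarith
  -- `b - w x` is allowed besides `w x`, since each application of `f` reflects `[0, b]`.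
  refine not_isMinimalMap_of_finite (D := {x | w x ∈ C ∨ b - w x ∈ C}) ?_ ?_ ?_
  · have h : {x | w x ∈ C ∨ b - w x ∈ C} ⊆
        ⋃ c ∈ C, ({x | w x = c} ∪ {x | w x = b - c}) := by
      rintro x (hx | hx)
      · exact Set.mem_biUnion hx (Or.inl rfl)
      · exact Set.mem_biUnion hx (Or.inr (by simp))
    exact (C.finite_toSet.biUnion fun c _ => (hfib c).union (hfib _)).subset h
  · -- The least element of a stable set is below every `l k`.
    have hmin := C.min'_mem hne
    obtain ⟨x, hx⟩ := hsurj (C.min' hne) (hCb _ hmin).1 (by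
      by_contra h
      have h1 := C.min'_le _ ((hC _ hmin 0).2 (by linarith))
      linarith [hl₀ 0])
    exact ⟨x, Or.inl (hx ▸ hmin)⟩
  · intro x
    refine ⟨hhalf _ _ (hw₀ _) (hw₀ _) (hw x), hhalf _ _ (hw₀ _) (hw₀ _) ?_⟩
    rcases hw x with h | ⟨k, h⟩ | h
    · exact Or.inl (by linarith)
    · exact Or.inr (Or.inl ⟨k, by linarith⟩)
    · exact Or.inr (Or.inr h.symm)

/-! ### The flipped exchange in coordinates -/

/-- The representative in `[0, 1)` of a point of the circle. -/
noncomputable def circleCoord (x : UnitAddCircle) : ℝ := (AddCircle.equivIco (1 : ℝ) 0 x : ℝ)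

lemma circleCoord_nonneg (x : UnitAddCircle) : 0 ≤ circleCoord x :=
  (AddCircle.equivIco (1 : ℝ) 0 x).2.1

lemma circleCoord_lt_one (x : UnitAddCircle) : circleCoord x < 1 :=
  (AddCircle.equivIco (1 : ℝ) 0 x).2.2.trans_eq (zero_add 1)

lemma circleCoord_injective : Function.Injective circleCoord :=
  Subtype.val_injective.comp (AddCircle.equivIco (1 : ℝ) 0).injective

lemma circleCoord_coe (t : ℝ) : circleCoord (t : UnitAddCircle) = Int.fract t := by
  have h := AddCircle.coe_equivIco_mk_apply (p := (1 : ℝ)) t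
  rwa [div_one, mul_one] at h

lemma circleCoord_coe_of_mem {t : ℝ} (h₀ : 0 ≤ t) (h₁ : t < 1) :
    circleCoord (t : UnitAddCircle) = t := by
  rw [circleCoord_coe, Int.fract_eq_self.2 ⟨h₀, h₁⟩]

lemma fract_eq_self_or_sub_one {t : ℝ} (h₀ : 0 ≤ t) (h₁ : t < 2) :
    ∃ n : ℝ, (n = 0 ∨ n = 1) ∧ Int.fract t = t - n := by
  rcases lt_or_ge t 1 with h | h
  · exact ⟨0, Or.inl rfl, by rw [Int.fract_eq_self.2 ⟨h₀, h⟩, sub_zero]⟩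
  · refine ⟨1, Or.inr rfl, ?_⟩
    rw [← Int.fract_sub_one]
    exact Int.fract_eq_self.2 ⟨by linarith, by linarith⟩

/-- The flipped exchange sends the coordinate `t` to `c - t + τ - n`, where `c` is the sum of the
end points of the interval containing `t`, and `n` is `0` or `1`. -/
lemma circleCoord_flippedCET3 {τ l₁ l₂ l₃ : ℝ} (hτ₀ : 0 ≤ τ) (hτ₁ : τ < 1)
    (hl₁ : 0 < l₁) (hl₂ : 0 < l₂) (hl₃ : 0 < l₃) (hl : l₁ + l₂ + l₃ = 1) (x : UnitAddCircle) :
    ∃ n : ℝ, (n = 0 ∨ n = 1) ∧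
      ((circleCoord x < l₁ ∧
        circleCoord (flippedCET3 τ l₁ l₂ l₃ x) = l₁ - circleCoord x + τ - n) ∨
      (l₁ ≤ circleCoord x ∧ circleCoord x < l₁ + l₂ ∧
        circleCoord (flippedCET3 τ l₁ l₂ l₃ x) = 2 * l₁ + l₂ - circleCoord x + τ - n) ∨
      (l₁ + l₂ ≤ circleCoord x ∧
        circleCoord (flippedCET3 τ l₁ l₂ l₃ x) = l₁ + l₂ + 1 - circleCoord x + τ - n)) := by
  have h₀ := circleCoord_nonneg x
  have h₁ := circleCoord_lt_one x
  have hF : flippedCET3 τ l₁ l₂ l₃ x = if circleCoord x < l₁ then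
      ((0 + l₁ - circleCoord x + τ : ℝ) : UnitAddCircle)
    else if circleCoord x < l₁ + l₂ then
      ((l₁ + (l₁ + l₂) - circleCoord x + τ : ℝ) : UnitAddCircle)
    else (((l₁ + l₂) + (l₁ + l₂ + l₃) - circleCoord x + τ : ℝ) : UnitAddCircle) := rfl
  split_ifs at hF with hc hc'
  · obtain ⟨n, hn, h⟩ := fract_eq_self_or_sub_one (t := 0 + l₁ - circleCoord x + τ)
      (by linarith) (by linarith)
    refine ⟨n, hn, Or.inl ⟨hc, ?_⟩⟩
    rw [hF, circleCoord_coe, h, zero_add]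
  · obtain ⟨n, hn, h⟩ := fract_eq_self_or_sub_one (t := l₁ + (l₁ + l₂) - circleCoord x + τ)
      (by linarith) (by linarith)
    refine ⟨n, hn, Or.inr (Or.inl ⟨by linarith, hc', ?_⟩)⟩
    rw [hF, circleCoord_coe, h]
    ring
  · obtain ⟨n, hn, h⟩ := fract_eq_self_or_sub_one
      (t := (l₁ + l₂) + (l₁ + l₂ + l₃) - circleCoord x + τ) (by linarith) (by linarith)
    refine ⟨n, hn, Or.inr (Or.inr ⟨by linarith, ?_⟩)⟩
    rw [hF, circleCoord_coe, h, hl]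

lemma flippedCET3_injective {τ l₁ l₂ l₃ : ℝ} (hτ₀ : 0 ≤ τ) (hτ₁ : τ < 1)
    (hl₁ : 0 < l₁) (hl₂ : 0 < l₂) (hl₃ : 0 < l₃) (hl : l₁ + l₂ + l₃ = 1) :
    Function.Injective (flippedCET3 τ l₁ l₂ l₃) := by
  intro x y hxy
  apply circleCoord_injective
  have hx₀ := circleCoord_nonneg x
  have hx₁ := circleCoord_lt_one x
  have hy₀ := circleCoord_nonneg y
  have hy₁ := circleCoord_lt_one y
  obtain ⟨n, hn, hx⟩ := circleCoord_flippedCET3 hτ₀ hτ₁ hl₁ hl₂ hl₃ hl x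
  obtain ⟨m, hm, hy⟩ := circleCoord_flippedCET3 hτ₀ hτ₁ hl₁ hl₂ hl₃ hl y
  rw [hxy] at hx
  rcases hn with rfl | rfl <;> rcases hm with rfl | rfl <;>
    rcases hx with ⟨hx1, hx2⟩ | ⟨hx1, hx2, hx3⟩ | ⟨hx1, hx2⟩ <;>
    rcases hy with ⟨hy1, hy2⟩ | ⟨hy1, hy2, hy3⟩ | ⟨hy1, hy2⟩ <;> linarith

/-- The distance of `t` from the left end point of its interval. -/
noncomputable def leftDist (l₁ l₂ t : ℝ) : ℝ :=
  if t < l₁ then t else if t < l₁ + l₂ then t - l₁ else t - (l₁ + l₂)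

/-- The distance of `t` from the right end point of its interval. -/
noncomputable def rightDist (l₁ l₂ t : ℝ) : ℝ :=
  if t < l₁ then l₁ - t else if t < l₁ + l₂ then l₁ + l₂ - t else 1 - t

/-- Between the flip of `x` and the point `F x` the rotation crosses an arc of length `τ`, which
contains one or two of the three division points; when it contains two, their distance is one of the
`l k`. The last alternative is the degenerate case of an arc with division points at both ends, which
occurs only if an interval has length `1 - τ`. -/
lemma leftDist_add_leftDist {τ l₁ l₂ l₃ : ℝ} (hτ₀ : 0 ≤ τ) (hτ₁ : τ < 1)
    (hl₁ : 0 < l₁) (hl₂ : 0 < l₂) (hl₃ : 0 < l₃) (hl : l₁ + l₂ + l₃ = 1)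
    (h₁ : l₁ ≤ τ) (h₂ : l₂ ≤ τ) (h₃ : l₃ ≤ τ)
    (h₁' : l₁ ≤ 1 - τ) (h₂' : l₂ ≤ 1 - τ) (h₃' : l₃ ≤ 1 - τ) (x : UnitAddCircle) :
    let u := leftDist l₁ l₂ (circleCoord x)
    let u' := leftDist l₁ l₂ (circleCoord (flippedCET3 τ l₁ l₂ l₃ x))
    u + u' = τ ∨ (u + u' = τ - l₁ ∨ u + u' = τ - l₂ ∨ u + u' = τ - l₃) ∨ (u = 0 ∧ u' = 0) := by
  have hx₀ := circleCoord_nonneg x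
  have hx₁ := circleCoord_lt_one x
  have hy₀ := circleCoord_nonneg (flippedCET3 τ l₁ l₂ l₃ x)
  have hy₁ := circleCoord_lt_one (flippedCET3 τ l₁ l₂ l₃ x)
  obtain ⟨n, hn, hx⟩ := circleCoord_flippedCET3 hτ₀ hτ₁ hl₁ hl₂ hl₃ hl x
  generalize circleCoord x = s at *
  generalize circleCoord (flippedCET3 τ l₁ l₂ l₃ x) = t at *
  dsimp only [leftDist]
  rcases hn with rfl | rfl <;>
    rcases hx with ⟨hx1, hx2⟩ | ⟨hx1, hx2, hx3⟩ | ⟨hx1, hx2⟩ <;>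
    split_ifs <;>
    first
    | (exfalso; linarith)
    | exact Or.inl (by linarith)
    | exact Or.inr (Or.inl (Or.inl (by linarith)))
    | exact Or.inr (Or.inl (Or.inr (Or.inl (by linarith))))
    | exact Or.inr (Or.inl (Or.inr (Or.inr (by linarith))))
    | exact Or.inr (Or.inr ⟨by linarith, by linarith⟩)

/-- The analogue of `leftDist_add_leftDist` for the complementary arc, of length `1 - τ`,
with the same degenerate case. -/
lemma rightDist_add_rightDist {τ l₁ l₂ l₃ : ℝ} (hτ₀ : 0 ≤ τ) (hτ₁ : τ < 1)
    (hl₁ : 0 < l₁) (hl₂ : 0 < l₂) (hl₃ : 0 < l₃) (hl : l₁ + l₂ + l₃ = 1)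
    (h₁ : l₁ ≤ τ) (h₂ : l₂ ≤ τ) (h₃ : l₃ ≤ τ)
    (h₁' : l₁ ≤ 1 - τ) (h₂' : l₂ ≤ 1 - τ) (h₃' : l₃ ≤ 1 - τ) (x : UnitAddCircle) :
    let u := rightDist l₁ l₂ (circleCoord x)
    let u' := rightDist l₁ l₂ (circleCoord (flippedCET3 τ l₁ l₂ l₃ x))
    u + u' = 1 - τ ∨ (u + u' = 1 - τ - l₁ ∨ u + u' = 1 - τ - l₂ ∨ u + u' = 1 - τ - l₃) ∨
      (u = 1 - τ ∧ u' = 1 - τ) := by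
  have hx₀ := circleCoord_nonneg x
  have hx₁ := circleCoord_lt_one x
  have hy₀ := circleCoord_nonneg (flippedCET3 τ l₁ l₂ l₃ x)
  have hy₁ := circleCoord_lt_one (flippedCET3 τ l₁ l₂ l₃ x)
  obtain ⟨n, hn, hx⟩ := circleCoord_flippedCET3 hτ₀ hτ₁ hl₁ hl₂ hl₃ hl x
  generalize circleCoord x = s at *
  generalize circleCoord (flippedCET3 τ l₁ l₂ l₃ x) = t at *
  dsimp only [rightDist]
  rcases hn with rfl | rfl <;>
    rcases hx with ⟨hx1, hx2⟩ | ⟨hx1, hx2, hx3⟩ | ⟨hx1, hx2⟩ <;>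
    split_ifs <;>
    first
    | (exfalso; linarith)
    | exact Or.inl (by linarith)
    | exact Or.inr (Or.inl (Or.inl (by linarith)))
    | exact Or.inr (Or.inl (Or.inr (Or.inl (by linarith))))
    | exact Or.inr (Or.inl (Or.inr (Or.inr (by linarith))))
    | exact Or.inr (Or.inr ⟨by linarith, by linarith⟩)

lemma infinite_unitAddCircle : Infinite UnitAddCircle :=
  have : Infinite (Set.Ico (0 : ℝ) (0 + 1)) := (Set.Ico_infinite (by norm_num)).to_subtype
  (AddCircle.equivIco (1 : ℝ) 0).infinite_iff.2 this

/-- The fibres of `w` are finite when `w` has three branches `a₁`, `a₂`, `a₃` of its inverse. -/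
lemma finite_fiber_circleCoord {w : ℝ → ℝ} {a₁ a₂ a₃ : ℝ → ℝ}
    (h : ∀ t, t = a₁ (w t) ∨ t = a₂ (w t) ∨ t = a₃ (w t)) (c : ℝ) :
    {x : UnitAddCircle | w (circleCoord x) = c}.Finite := by
  refine Set.Finite.subset (Set.Finite.preimage circleCoord_injective.injOn
    (Set.toFinite {a₁ c, a₂ c, a₃ c})) ?_
  intro x hx
  have := h (circleCoord x)
  rw [show w (circleCoord x) = c from hx] at this
  simpa using this

lemma not_isMinimalMap_of_fixed {τ l₁ l₂ l₃ : ℝ} (hτ₀ : 0 ≤ τ) (hτ₁ : τ < 1)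
    (hl₁ : 0 < l₁) (hl₂ : 0 < l₂) (hl₃ : 0 < l₃) (hl : l₁ + l₂ + l₃ = 1) {x : UnitAddCircle}
    (hx : flippedCET3 τ l₁ l₂ l₃ x = x) : ¬ IsMinimalMap (flippedCET3 τ l₁ l₂ l₃) := by
  have := infinite_unitAddCircle
  refine not_isMinimalMap_of_finite (Set.finite_singleton x) (Set.singleton_nonempty x) fun y => ?_
  rw [Set.mem_singleton_iff, Set.mem_singleton_iff]
  refine ⟨fun h => by rw [h, hx], fun h => ?_⟩
  exact flippedCET3_injective hτ₀ hτ₁ hl₁ hl₂ hl₃ hl (h.trans hx.symm)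

/-- If an interval is longer than `τ` or than `1 - τ`, the flip of this interval followed by the
rotation has a fixed point in it. -/
lemma exists_fixed {τ l₁ l₂ l₃ : ℝ} (hτ₀ : 0 ≤ τ) (hτ₁ : τ < 1)
    (hl₁ : 0 < l₁) (hl₂ : 0 < l₂) (hl₃ : 0 < l₃) (hl : l₁ + l₂ + l₃ = 1)
    {m : ℝ} (hm : m = τ ∨ m = τ - 1) (h : |m| < l₁ ∨ |m| < l₂ ∨ |m| < l₃) :
    ∃ x, flippedCET3 τ l₁ l₂ l₃ x = x := by
  have hcoe : ∀ s t : ℝ, s = t + m → ((t + τ : ℝ) : UnitAddCircle) = (s : UnitAddCircle) := by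
    rintro s t rfl
    rcases hm with rfl | rfl
    · rfl
    · rw [← AddCircle.coe_add_period (1 : ℝ) (t + (τ - 1))]
      congr 1
      ring
  have hF : ∀ t : ℝ, 0 ≤ t → t < 1 → flippedCET3 τ l₁ l₂ l₃ t = if t < l₁ then
      ((0 + l₁ - t + τ : ℝ) : UnitAddCircle)
    else if t < l₁ + l₂ then ((l₁ + (l₁ + l₂) - t + τ : ℝ) : UnitAddCircle)
    else (((l₁ + l₂) + (l₁ + l₂ + l₃) - t + τ : ℝ) : UnitAddCircle) := by
    intro t h0 h1
    have : ((AddCircle.equivIco (1 : ℝ) 0 (t : UnitAddCircle) : ℝ)) = t :=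
      circleCoord_coe_of_mem h0 h1
    simp only [flippedCET3, this]
  simp only [abs_lt] at h
  rcases h with h | h | h
  · refine ⟨((l₁ + m) / 2 : ℝ), ?_⟩
    rw [hF _ (by linarith) (by linarith), if_pos (by linarith)]
    exact hcoe _ _ (by ring)
  · refine ⟨((2 * l₁ + l₂ + m) / 2 : ℝ), ?_⟩
    rw [hF _ (by linarith) (by linarith), if_neg (by linarith), if_pos (by linarith)]
    exact hcoe _ _ (by ring)
  · refine ⟨((2 * l₁ + 2 * l₂ + l₃ + m) / 2 : ℝ), ?_⟩
    rw [hF _ (by linarith) (by linarith), if_neg (by linarith), if_neg (by linarith)]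
    exact hcoe _ _ (by ring)

/-! ### The value of `τ` -/

/-- A minimal fully flipped 3-interval exchange transformation of the circle has `τ = 1 / 2`. -/
theorem mainTheorem2 (τ l₁ l₂ l₃ : ℝ) (hτ₀ : 0 ≤ τ) (hτ₁ : τ < 1)
    (hl₁ : 0 < l₁) (hl₂ : 0 < l₂) (hl₃ : 0 < l₃) (hl : l₁ + l₂ + l₃ = 1)
    (hmin : IsMinimalMap (flippedCET3 τ l₁ l₂ l₃)) :
    τ = 1 / 2 := by
  have hnofix : ∀ m : ℝ, m = τ ∨ m = τ - 1 → l₁ ≤ |m| ∧ l₂ ≤ |m| ∧ l₃ ≤ |m| := by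
    intro m hm
    by_contra hcon
    obtain ⟨x, hx⟩ := exists_fixed hτ₀ hτ₁ hl₁ hl₂ hl₃ hl hm (by
      by_contra! h
      exact hcon h)
    exact not_isMinimalMap_of_fixed hτ₀ hτ₁ hl₁ hl₂ hl₃ hl hx hmin
  obtain ⟨h₁, h₂, h₃⟩ := hnofix τ (Or.inl rfl)
  obtain ⟨h₁', h₂', h₃'⟩ := hnofix (τ - 1) (Or.inr rfl)
  rw [abs_of_nonneg hτ₀] at h₁ h₂ h₃
  rw [abs_of_nonpos (by linarith), neg_sub] at h₁' h₂' h₃'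
  have := infinite_unitAddCircle
  have hl₀ : ∀ k, 0 < (![l₁, l₂, l₃] : Fin 3 → ℝ) k := by
    intro k
    fin_cases k <;> simpa
  rcases lt_trichotomy τ (1 / 2) with hτ | hτ | hτ
  · refine absurd hmin (not_isMinimalMap_of_dist (l := ![l₁, l₂, l₃]) (b := τ) hl₀ (by simpa)
      (fun k => by fin_cases k <;> simpa) hτ (fun x => leftDist l₁ l₂ (circleCoord x)) ?_ ?_ ?_ ?_)
    · intro x
      rcases leftDist_add_leftDist hτ₀ hτ₁ hl₁ hl₂ hl₃ hl h₁ h₂ h₃ h₁' h₂' h₃' x with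
        h | (h | h | h) | h
      · exact Or.inl h
      · exact Or.inr (Or.inl ⟨0, h⟩)
      · exact Or.inr (Or.inl ⟨1, h⟩)
      · exact Or.inr (Or.inl ⟨2, h⟩)
      · exact Or.inr (Or.inr ⟨Or.inl h.1, Or.inl h.2⟩)
    · intro x
      have := circleCoord_nonneg x
      dsimp only [leftDist]
      split_ifs <;> linarith
    · refine finite_fiber_circleCoord (a₁ := fun c => c) (a₂ := fun c => c + l₁)
        (a₃ := fun c => c + (l₁ + l₂)) fun t => ?_
      unfold leftDist
      split_ifs <;> simp
    · intro c hc₀ hc₁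
      replace hc₁ : c < l₁ := hc₁
      refine ⟨(c : ℝ), ?_⟩
      rw [circleCoord_coe_of_mem hc₀.le (by linarith), leftDist, if_pos hc₁]
  · exact hτ
  · refine absurd hmin (not_isMinimalMap_of_dist (l := ![l₁, l₂, l₃]) (b := 1 - τ) hl₀ (by simpa)
      (fun k => by fin_cases k <;> simpa) (by linarith)
      (fun x => rightDist l₁ l₂ (circleCoord x)) ?_ ?_ ?_ ?_)
    · intro x
      rcases rightDist_add_rightDist hτ₀ hτ₁ hl₁ hl₂ hl₃ hl h₁ h₂ h₃ h₁' h₂' h₃' x with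
        h | (h | h | h) | h
      · exact Or.inl h
      · exact Or.inr (Or.inl ⟨0, h⟩)
      · exact Or.inr (Or.inl ⟨1, h⟩)
      · exact Or.inr (Or.inl ⟨2, h⟩)
      · exact Or.inr (Or.inr ⟨Or.inr h.1, Or.inr h.2⟩)
    · intro x
      have := circleCoord_lt_one x
      dsimp only [rightDist]
      split_ifs <;> linarith
    · refine finite_fiber_circleCoord (a₁ := fun c => l₁ - c) (a₂ := fun c => l₁ + l₂ - c)
        (a₃ := fun c => 1 - c) fun t => ?_
      unfold rightDist
      split_ifs <;> simp
    · intro c hc₀ hc₁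
      replace hc₁ : c < l₁ := hc₁
      refine ⟨((l₁ - c : ℝ)), ?_⟩
      rw [circleCoord_coe_of_mem (by linarith) (by linarith), rightDist, if_pos (by linarith)]
      ring
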